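/- Let $\lambda$ be an infinite regular cardinal and let $\mathcal R$ be a small additive category which has $\lambda$-small products (products of families indexed by sets of cardinality $<\lambda$). Let $\mathcal M=\mathcal R\text{-}\mathrm{Mod}$ be the category of left $\mathcal R$-modules, i.e. of additive functors $\mathcal R\to\mathbf{Ab}$, and let $\mathcal N\subseteq\mathcal M$ be the full subcategory of those modules which preserve $\lambda$-small products. Write $\mathrm{fun}_\lambda\,\mathcal N$ for the class of functors $\mathcal N\to\mathbf{Ab}$ that preserve $\lambda$-directed colimits and all (small) products, and $\mathrm{fun}\,\mathcal M$ for the class of functors $\mathcal M\to\mathbf{Ab}$ that preserve directed colimits and all (small) products. For an object $n$ of $\mathcal R$, a pp-$n$-formula $\phi$ is a cospan $n\xrightarrow{A}m\xleftarrow{B}l$ in $\mathcal R$; for $M\in\mathcal M$ put $$F_\phi M=\{x\in M(n) : M(A)x=M(B)y\text{ for some }y\in M(l)\},$$ a subgroup of $M(n)$, functorial in $M$. A pp-pair $\phi/\psi$ consists of two pp-$n$-formulas (for the same object $n$) such that $F_\psi M\subseteq F_\phi M$ for all $M\in\mathcal M$, and $F_{\phi/\psi}=F_\phi/F_\psi:\mathcal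 M\to\mathbf{Ab}$. Then 1. $\mathrm{fun}_\lambda\,\mathcal N=\{F|_{\mathcal N} : F\in\mathrm{fun}\,\mathcal M\}$; that is, a functor $G:\mathcal N\to\mathbf{Ab}$ preserves $\lambda$-directed colimits and products if and only if it is the restriction to $\mathcal N$ of a functor $\mathcal M\to\mathbf{Ab}$ that preserves directed colimits and products. 2. A functor $G:\mathcal N\to\mathbf{Ab}$ belongs to $\mathrm{fun}_\lambda\,\mathcal N$ if and only if there is a pp-pair $\phi/\psi$ for left $\mathcal R$-modules with $G\simeq F_{\phi/\psi}|_{\mathcal N}$. -/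

import Mathlib

/-!
Let `(A)` denote the module with one generator and one relation `A` in `R`, so that `Hom((A), X)`
is the set of solutions of `A x = 0` in `X`. It preserves all existing products, and every object
of `ProdMod κ R` is the canonical `κ`-filtered colimit of such modules: fewer than `κ` elements of
`X` form a single element over a product in `R`, and fewer than `κ` relations combine into one.

Let `G` preserve `κ`-filtered colimits and products. Every element of `G X` then comes from a module
`(A)`. There is only a set of pairs `(A, y)` with `y` in `G (A)`, so all of them are the components
of one element of `G` at a product, and lifting this element to some `(A)` gives `y` in `G (A)` that
generates `G`. The same argument, applied to the morphisms annihilating `y`, gives an exact sequence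
`((B), -) ⟶ ((A), -) ⟶ G ⟶ 0`. By the Yoneda lemma the first map is given by a morphism `e` of `R`,
and hence `G` is the functor of the pp-pair of `A x = 0` and `x = e y, B y = 0`.
-/

open CategoryTheory Limits

universe u

noncomputable section

namespace LambdaModules

/-- Left `R`-modules over a small preadditive category `R`: additive functors `R ⥤ Ab`. -/
abbrev LeftMod (R : Type u) [SmallCategory R] [Preadditive R] : Type (u + 1) :=
  R ⥤+ AddCommGrpCat.{u}

/-- `R` has `κ`-small products. -/
def HasSmallProducts (κ : Cardinal.{u}) (R : Type u) [SmallCategory R] : Prop :=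
  ∀ J : Type u, Cardinal.mk J < κ → HasProductsOfShape J R

/-- The left `R`-modules that preserve `κ`-small products. -/
def preservesSmallProducts (κ : Cardinal.{u}) (R : Type u) [SmallCategory R] [Preadditive R] :
    ObjectProperty (LeftMod R) :=
  fun M => ∀ J : Type u, Cardinal.mk J < κ → PreservesLimitsOfShape (Discrete J) M.obj

/-- The full subcategory of `LeftMod R` on the modules that preserve `κ`-small products. -/
abbrev ProdMod (κ : Cardinal.{u}) (R : Type u) [SmallCategory R] [Preadditive R] :
    Type (u + 1) :=
  (preservesSmallProducts κ R).FullSubcategory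

/-- Restriction to `ProdMod κ R` of a functor on `LeftMod R`. -/
abbrev restrict (κ : Cardinal.{u}) {R : Type u} [SmallCategory R] [Preadditive R]
    (F : LeftMod R ⥤ AddCommGrpCat.{u}) : ProdMod κ R ⥤ AddCommGrpCat.{u} :=
  (preservesSmallProducts κ R).ι ⋙ F

/-- The functors `C ⥤ Ab` that preserve `κ`-directed (equivalently, `κ`-filtered) colimits
and all (small) products. -/
def funCard (κ : Cardinal.{u}) [Fact κ.IsRegular] (C : Type (u + 1)) [Category.{u} C] :
    ObjectProperty (C ⥤ AddCommGrpCat.{u}) :=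
  fun F => F.IsCardinalAccessible κ ∧ ∀ J : Type u, PreservesLimitsOfShape (Discrete J) F

/-- The functors `C ⥤ Ab` that preserve directed colimits and all (small) products:
the case `κ = ℵ₀`. -/
def funFin (C : Type (u + 1)) [Category.{u} C] : ObjectProperty (C ⥤ AddCommGrpCat.{u}) :=
  haveI : Fact (Cardinal.aleph0.{u}).IsRegular := Cardinal.fact_isRegular_aleph0
  funCard Cardinal.aleph0.{u} C

/-- A pp-`n`-formula for left `R`-modules: a cospan `n ⟶ m ⟵ l` in `R`. -/
structure PPFormula (R : Type u) [SmallCategory R] (n : R) where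
  m : R
  l : R
  A : n ⟶ m
  B : l ⟶ m

variable {R : Type u} [SmallCategory R] [Preadditive R]

/-- The solution set of `φ` in `M`: the `x` in `M n` such that `A x = B y` for some `y` in
`M l`. -/
def PPFormula.sol {n : R} (φ : PPFormula R n) (M : LeftMod R) : AddSubgroup (M.obj.obj n) where
  carrier := {x | ∃ y : M.obj.obj φ.l, M.obj.map φ.A x = M.obj.map φ.B y}
  zero_mem' := ⟨0, by simp⟩
  add_mem' := by
    rintro a b ⟨y, hy⟩ ⟨z, hz⟩
    exact ⟨y + z, by simp [hy, hz]⟩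
  neg_mem' := by
    rintro a ⟨y, hy⟩
    exact ⟨-y, by simp [hy]⟩

lemma PPFormula.sol_map {n : R} (φ : PPFormula R n) {M N : LeftMod R} (f : M ⟶ N)
    {x : M.obj.obj n} (hx : x ∈ φ.sol M) : f.hom.app n x ∈ φ.sol N := by
  obtain ⟨y, hy⟩ := hx
  refine ⟨f.hom.app φ.l y, ?_⟩
  rw [← NatTrans.naturality_apply, ← NatTrans.naturality_apply, hy]

/-- The map on solution sets induced by a morphism of modules. -/
def PPFormula.solMap {n : R} (φ : PPFormula R n) {M N : LeftMod R} (f : M ⟶ N) :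
    φ.sol M →+ φ.sol N :=
  ((f.hom.app n).hom.comp (φ.sol M).subtype).codRestrict (φ.sol N)
    (fun x => φ.sol_map f x.2)

/-- A pp-`n`-pair `φ/ψ`: two pp-`n`-formulas such that the solution set of `ψ` is contained in
that of `φ` in every left `R`-module. -/
structure PPPair (R : Type u) [SmallCategory R] [Preadditive R] (n : R) where
  φ : PPFormula R n
  ψ : PPFormula R n
  le : ∀ M : LeftMod R, ψ.sol M ≤ φ.sol M

/-- The functor `F_{φ/ψ} = F_φ / F_ψ` on left `R`-modules. -/
def PPPair.functor {n : R} (p : PPPair R n) : LeftMod R ⥤ AddCommGrpCat.{u} where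
  obj M := AddCommGrpCat.of (p.φ.sol M ⧸ (p.ψ.sol M).addSubgroupOf (p.φ.sol M))
  map {M N} f := AddCommGrpCat.ofHom
    (QuotientAddGroup.map ((p.ψ.sol M).addSubgroupOf (p.φ.sol M))
      ((p.ψ.sol N).addSubgroupOf (p.φ.sol N)) (p.φ.solMap f)
      (fun _ hx => p.ψ.sol_map f hx))
  map_id M := by
    ext x
    rfl
  map_comp f g := by
    ext x
    rfl

end LambdaModules

end

universe w

noncomputable section

namespace LambdaModules

section AbelianGroups

variable {J : Type w} {K : Discrete J ⥤ AddCommGrpCat.{w}} {c : Cone K}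

lemma exists_forall_π_eq_of_isLimit (hc : IsLimit c) (y : ∀ j, K.obj ⟨j⟩) :
    ∃ x : c.pt, ∀ j, c.π.app ⟨j⟩ x = y j := by
  let s : (K ⋙ forget AddCommGrpCat.{w}).sections := ⟨fun j => y j.as, by
    rintro ⟨i⟩ ⟨j⟩ ⟨⟨rfl : i = j⟩⟩
    exact ConcreteCategory.congr_hom (K.map_id ⟨i⟩) _⟩
  let hc' := isLimitOfPreserves (forget AddCommGrpCat.{w}) hc
  exact ⟨(Types.isLimitEquivSections hc').symm s, fun j =>
    Types.isLimitEquivSections_symm_apply hc' s ⟨j⟩⟩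

lemma nonempty_isLimit_of_discrete (hinj : ∀ x : c.pt, (∀ j, c.π.app ⟨j⟩ x = 0) → x = 0)
    (hsurj : ∀ y : ∀ j, K.obj ⟨j⟩, ∃ x : c.pt, ∀ j, c.π.app ⟨j⟩ x = y j) :
    Nonempty (IsLimit c) := by
  suffices Nonempty (IsLimit ((forget AddCommGrpCat.{w}).mapCone c)) from
    ⟨isLimitOfReflects _ this.some⟩
  rw [Types.isLimit_iff]
  intro s _
  obtain ⟨x, hx⟩ := hsurj fun j => s ⟨j⟩
  refine ⟨x, fun j => hx j.as, fun x' hx' => ?_⟩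
  refine (sub_eq_zero (G := c.pt)).1 (hinj _ fun j => ?_)
  rw [map_sub, hx j, sub_eq_zero]
  exact hx' ⟨j⟩

end AbelianGroups

section

variable {J : Type*} [Category* J] [IsFiltered J] {K : J ⥤ AddCommGrpCat.{w}} {c : Cocone K}
  [PreservesColimitsOfShape J (forget AddCommGrpCat.{w})]

lemma exists_map_eq_zero_of_isColimit (hc : IsColimit c) {j : J} {x : K.obj j}
    (hx : c.ι.app j x = 0) : ∃ (k : J) (f : j ⟶ k), K.map f x = 0 := by
  simpa only [map_zero] using (hc.eq_iff' x 0).1 (hx.trans (map_zero _).symm)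

lemma nonempty_isColimit_of_isFiltered [HasColimitsOfShape J AddCommGrpCat.{w}]
    (hsurj : ∀ x : c.pt, ∃ (j : J) (y : K.obj j), c.ι.app j y = x)
    (hinj : ∀ (j : J) (y : K.obj j), c.ι.app j y = 0 → ∃ (k : J) (f : j ⟶ k), K.map f y = 0) :
    Nonempty (IsColimit c) := by
  have : ReflectsColimitsOfShape J (forget AddCommGrpCat.{w}) :=
    reflectsColimitsOfShape_of_reflectsIsomorphisms
  refine ⟨isColimitOfReflects (forget AddCommGrpCat.{w})
    (Types.FilteredColimit.isColimitOf' _ _ (fun x => ?_) (fun j x y h => ?_))⟩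
  · obtain ⟨j, y, hy⟩ := hsurj x
    exact ⟨j, y, hy.symm⟩
  · have hxy : c.ι.app j (show K.obj j from x) = c.ι.app j y := h
    obtain ⟨k, f, hf⟩ := hinj j ((show K.obj j from x) - y) (by rw [map_sub, hxy, sub_self])
    rw [map_sub, sub_eq_zero] at hf
    exact ⟨k, f, hf⟩

end

section CommuteProducts

variable {κ : Cardinal.{w}} [Fact κ.IsRegular] {I J : Type w} [SmallCategory J]
  [IsCardinalFiltered J κ] {K : Discrete I ⥤ J ⥤ AddCommGrpCat.{w}} {c : Cone K}

lemma colimMap_ι_apply {M N : J ⥤ AddCommGrpCat.{w}} (f : M ⟶ N) (j : J) (x : M.obj j) :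
    colimMap f (colimit.ι M j x) = colimit.ι N j (f.app j x) := by
  rw [← ConcreteCategory.comp_apply, ι_colimMap, ConcreteCategory.comp_apply]

lemma eq_zero_of_forall_colimMap_π_eq_zero (hI : HasCardinalLT I κ) (hc : IsLimit c)
    (x : ↑(colimit c.pt)) (hx : ∀ i : I, colimMap (c.π.app ⟨i⟩) x = 0) : x = 0 := by
  have := isFiltered_of_isCardinalFiltered J κ
  obtain ⟨j, y, rfl⟩ := Concrete.colimit_exists_rep c.pt x
  choose k f hf using fun i => exists_map_eq_zero_of_isColimit
    (colimit.isColimit (K.obj ⟨i⟩)) ((colimMap_ι_apply _ j y).symm.trans (hx i))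
  obtain ⟨l, a, b, hab⟩ := IsCardinalFiltered.wideSpan f hI
  have hy : c.pt.map b y = 0 := by
    refine Concrete.isLimit_ext _ (isLimitOfPreserves ((evaluation _ _).obj l) hc) _ _ fun ⟨i⟩ => ?_
    refine (NatTrans.naturality_apply (c.π.app ⟨i⟩) b y).trans (Eq.trans ?_ (map_zero _).symm)
    rw [← hab i, Functor.map_comp_apply, hf, map_zero]
  rw [← colimit.w_apply _ b, hy, map_zero]

lemma exists_forall_colimMap_π_eq (hI : HasCardinalLT I κ) (hc : IsLimit c)
    (y : ∀ i : I, ↑(colimit (K.obj ⟨i⟩))) :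
    ∃ x : ↑(colimit c.pt), ∀ i, colimMap (c.π.app ⟨i⟩) x = y i := by
  have := isFiltered_of_isCardinalFiltered J κ
  choose j z hz using fun i => Concrete.colimit_exists_rep (K.obj ⟨i⟩) (y i)
  obtain ⟨x, hx⟩ := exists_forall_π_eq_of_isLimit
    (isLimitOfPreserves ((evaluation _ _).obj (IsCardinalFiltered.max j hI)) hc)
    fun i => (K.obj ⟨i⟩).map (IsCardinalFiltered.toMax j hI i) (z i)
  refine ⟨colimit.ι c.pt _ x, fun i => ?_⟩
  refine (colimMap_ι_apply _ _ x).trans ?_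
  rw [← hz i, ← colimit.w_apply _ (IsCardinalFiltered.toMax j hI i)]
  exact congrArg _ (hx i)

variable (κ J) in
lemma preservesLimitsOfShape_colim (hI : HasCardinalLT I κ) :
    PreservesLimitsOfShape (Discrete I) (colim : (J ⥤ AddCommGrpCat.{w}) ⥤ AddCommGrpCat.{w}) where
  preservesLimit := ⟨fun hc => nonempty_isLimit_of_discrete
    (eq_zero_of_forall_colimMap_π_eq_zero hI hc) (exists_forall_colimMap_π_eq hI hc)⟩

end CommuteProducts

lemma isClosedUnderLimitsOfShape_preservesLimitsOfShape (K K' C D : Type*) [Category* K]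
    [Category* K'] [Category* C] [Category* D] [HasLimitsOfShape K' D] :
    (ObjectProperty.preservesLimitsOfShape K :
      ObjectProperty (C ⥤ D)).IsClosedUnderLimitsOfShape K' where
  limitsOfShape_le := by
    rintro G ⟨h⟩
    have : PreservesLimitsOfShape K h.diag.flip :=
      preservesLimitsOfShape_of_evaluation _ _ h.prop_diag_obj
    exact preservesLimitsOfShape_of_natIso
      (h.isLimit.conePointUniqueUpToIso (limit.isLimit h.diag) ≪≫ limitIsoFlipCompLim h.diag).symm

section Presentations

/-- For `y : G A` and `g : A ⟶ B`, exactness of `(B, -) ⟶ (A, -) ⟶ G ⟶ 0`, where the first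
transformation is precomposition with `g` and the second one corresponds to `y` under the Yoneda
lemma. -/
structure IsPresentation {C : Type*} [Category* C] (G : C ⥤ AddCommGrpCat.{w}) {A B : C}
    (g : A ⟶ B) (y : G.obj A) : Prop where
  exists_map_eq {X : C} (x : G.obj X) : ∃ f : A ⟶ X, G.map f y = x
  map_eq_zero_iff {X : C} (f : A ⟶ X) : G.map f y = 0 ↔ ∃ h, g ≫ h = f

/-- The additive map `(A, X) ⟶ G X` corresponding to an element of `G A` under the Yoneda lemma. -/
def yonedaHom {C : Type*} [Category* C] [Preadditive C]
    (G : C ⥤ AddCommGrpCat.{w}) [G.Additive] {A : C} (y : G.obj A) (X : C) : (A ⟶ X) →+ G.obj X :=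
  AddMonoidHom.mk' (fun f => G.map f y) fun f f' => by
    rw [Functor.map_add, AddCommGrpCat.hom_add_apply]

namespace IsPresentation

section

variable {C : Type*} [Category* C] {G : C ⥤ AddCommGrpCat.{w}} {A B : C} {g : A ⟶ B} {y : G.obj A}
  (hG : IsPresentation G g y)

include hG

lemma map_self_eq_zero : G.map g y = 0 :=
  (hG.map_eq_zero_iff g).2 ⟨𝟙 B, Category.comp_id g⟩

lemma natTrans_ext {H : C ⥤ AddCommGrpCat.{w}} {α β : G ⟶ H} (h : α.app A y = β.app A y) :
    α = β := by
  ext X x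
  obtain ⟨f, rfl⟩ := hG.exists_map_eq x
  rw [NatTrans.naturality_apply, NatTrans.naturality_apply, h]

lemma preservesProducts (J : Type w) : PreservesLimitsOfShape (Discrete J) G := by
  refine ⟨⟨fun {c} hc => nonempty_isLimit_of_discrete (fun x hx => ?_) (fun x => ?_)⟩⟩
  · obtain ⟨f, rfl⟩ := hG.exists_map_eq x
    choose h hh using fun j => (hG.map_eq_zero_iff (f ≫ c.π.app ⟨j⟩)).1
      ((Functor.map_comp_apply _ _ _ _).trans (hx j))
    refine (hG.map_eq_zero_iff f).2
      ⟨hc.lift ⟨B, Discrete.natTrans fun j => h j.as⟩, hc.hom_ext fun j => ?_⟩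
    rw [Category.assoc, hc.fac]
    exact hh j.as
  · choose f hf using fun j => hG.exists_map_eq (x j)
    let s : A ⟶ c.pt := hc.lift ⟨A, Discrete.natTrans fun j => f j.as⟩
    have hs (j : J) : s ≫ c.π.app ⟨j⟩ = f j := hc.fac _ ⟨j⟩
    refine ⟨G.map s y, fun j => ?_⟩
    rw [← hf j, ← hs j, Functor.map_comp_apply]
    rfl

end

variable {C : Type*} [Category* C] [Preadditive C] {G H : C ⥤ AddCommGrpCat.{w}} [G.Additive]
  [H.Additive] {A B : C} {g : A ⟶ B} {y : G.obj A}

lemma exists_natTrans (hG : IsPresentation G g y) (z : H.obj A) (hz : H.map g z = 0) :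
    ∃ α : G ⟶ H, α.app A y = z := by
  have hker (X : C) : (yonedaHom G y X).ker ≤ (yonedaHom H z X).ker := fun f hf => by
    obtain ⟨h, rfl⟩ := (hG.map_eq_zero_iff f).1 hf
    change H.map (g ≫ h) z = 0
    rw [Functor.map_comp_apply, hz, map_zero]
  let a (X : C) : G.obj X →+ H.obj X := (yonedaHom G y X).liftOfSurjective
    hG.exists_map_eq ⟨yonedaHom H z X, hker X⟩
  have ha {X : C} (f : A ⟶ X) : a X (G.map f y) = H.map f z :=
    (yonedaHom G y X).liftOfRightInverse_comp_apply _ _ ⟨yonedaHom H z X, hker X⟩ f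
  refine ⟨{ app X := AddCommGrpCat.ofHom (a X), naturality X Y f := ?_ }, ?_⟩
  · ext x
    obtain ⟨h, rfl⟩ := hG.exists_map_eq x
    change a Y (G.map f (G.map h y)) = H.map f (a X (G.map h y))
    rw [ha, ← Functor.map_comp_apply, ha, Functor.map_comp_apply]
  · have := ha (𝟙 A)
    rwa [Functor.map_id_apply, Functor.map_id_apply] at this

lemma nonempty_iso (hG : IsPresentation G g y) {z : H.obj A} (hH : IsPresentation H g z) :
    Nonempty (G ≅ H) := by
  obtain ⟨α, hα⟩ := hG.exists_natTrans z hH.map_self_eq_zero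
  obtain ⟨β, hβ⟩ := hH.exists_natTrans y hG.map_self_eq_zero
  refine ⟨⟨α, β, hG.natTrans_ext ?_, hH.natTrans_ext ?_⟩⟩
  · change β.app A (α.app A y) = y
    rw [hα, hβ]
  · change α.app A (β.app A z) = z
    rw [hβ, hα]

end IsPresentation

end Presentations

section

variable {C : Type*} [Category.{w} C]

lemma exists_generator {ι : Type w} (S : ι → C) (T : C ⥤ Type w)
    (hprod : ∀ (ι : Type w) (X : ι → C) (x : ∀ i, T.obj (X i)),
      ∃ (P : C) (z : T.obj P) (π : ∀ i, P ⟶ X i), ∀ i, T.map (π i) z = x i)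
    (hrep : ∀ (X : C) (x : T.obj X), ∃ (i : ι) (f : S i ⟶ X) (y : T.obj (S i)), T.map f y = x) :
    ∃ (i : ι) (y : T.obj (S i)), ∀ (X : C) (x : T.obj X), ∃ f : S i ⟶ X, T.map f y = x := by
  obtain ⟨P, z, π, hz⟩ := hprod (Σ i, T.obj (S i)) (fun a => S a.1) fun a => a.2
  obtain ⟨i, p, y, rfl⟩ := hrep P z
  refine ⟨i, y, fun X x => ?_⟩
  obtain ⟨j, f, s, rfl⟩ := hrep X x
  refine ⟨p ≫ π ⟨j, s⟩ ≫ f, ?_⟩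
  rw [Functor.map_comp_apply, Functor.map_comp_apply, hz ⟨j, s⟩]

/-- The subfunctor of `(A, -)` of the morphisms `f` with `G f y = 0`: the kernel of the
transformation `(A, -) ⟶ G` corresponding to `y`. -/
def annihilator (G : C ⥤ AddCommGrpCat.{w}) {A : C} (y : G.obj A) :
    Subfunctor (coyoneda.obj (Opposite.op A)) where
  obj X := {f | G.map f y = 0}
  map {X Y} g f (hf : G.map f y = 0) := by
    change G.map (f ≫ g) y = 0
    rw [Functor.map_comp_apply, hf, map_zero]

section Dense

/-- The cocone with point `X` over the category of all morphisms `F j ⟶ X`. -/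
@[simps]
def canonicalCocone {J : Type*} [Category* J] (F : J ⥤ C) (X : C) :
    Cocone (CostructuredArrow.proj F X ⋙ F) where
  pt := X
  ι := { app a := a.hom
         naturality _ _ f := (CostructuredArrow.w f).trans (Category.comp_id _).symm }

lemma nonempty_isColimit_canonicalCocone_iff {J : Type*} [Category* J] {F : J ⥤ C} {X : C} :
    Nonempty (IsColimit (canonicalCocone F X)) ↔ F.isDenseAt X :=
  (IsColimit.equivIsoColimit (Cocone.ext (Iso.refl X) fun a =>
    (Category.comp_id _).trans (Category.id_comp a.hom).symm)).nonempty_congr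

variable {J : Type*} [Category* J] (F : J ⥤ C) [F.IsDense] (G : C ⥤ AddCommGrpCat.{w}) {X : C}
  [PreservesColimitsOfShape (CostructuredArrow F X) G]
  [PreservesColimitsOfShape (CostructuredArrow F X) (forget AddCommGrpCat.{w})]

lemma exists_map_eq_of_isDense (x : G.obj X) :
    ∃ (j : J) (f : F.obj j ⟶ X) (y : G.obj (F.obj j)), G.map f y = x := by
  obtain ⟨hc⟩ := nonempty_isColimit_canonicalCocone_iff.2 (Functor.IsDense.isDenseAt F X)
  obtain ⟨a, y, hy⟩ := Concrete.isColimit_exists_rep _ (isColimitOfPreserves G hc) x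
  exact ⟨a.left, a.hom, y, hy⟩

lemma exists_fac_map_eq_zero_of_isDense [IsFiltered (CostructuredArrow F X)] {j : J}
    (y : G.obj (F.obj j)) (f : F.obj j ⟶ X) (hf : G.map f y = 0) :
    ∃ (k : J) (g : j ⟶ k) (h : F.obj k ⟶ X), F.map g ≫ h = f ∧ G.map (F.map g) y = 0 := by
  obtain ⟨hc⟩ := nonempty_isColimit_canonicalCocone_iff.2 (Functor.IsDense.isDenseAt F X)
  obtain ⟨a, g, hg⟩ := exists_map_eq_zero_of_isColimit (isColimitOfPreserves G hc)
    (j := CostructuredArrow.mk f) (x := y) hf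
  exact ⟨a.left, g.left, a.hom, CostructuredArrow.w g, hg⟩

end Dense

section Products

lemma exists_forall_map_π_eq (G : C ⥤ AddCommGrpCat.{w}) {I : Type w} (X : I → C) [HasProduct X]
    [PreservesLimit (Discrete.functor X) G] (x : ∀ i, G.obj (X i)) :
    ∃ z : G.obj (∏ᶜ X), ∀ i, G.map (Pi.π X i) z = x i :=
  exists_forall_π_eq_of_isLimit (isLimitOfPreserves G (limit.isLimit (Discrete.functor X))) x

lemma eq_zero_of_forall_map_π_eq_zero (G : C ⥤ AddCommGrpCat.{w}) {I : Type w} {X : I → C}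
    [HasProduct X] [PreservesLimit (Discrete.functor X) G] {x : G.obj (∏ᶜ X)}
    (h : ∀ i, G.map (Pi.π X i) x = 0) : x = 0 :=
  Concrete.isLimit_ext _ (isLimitOfPreserves G (limit.isLimit (Discrete.functor X))) _ _
    fun ⟨i⟩ => (h i).trans (map_zero _).symm

variable [HasProducts.{w} C] (G : C ⥤ AddCommGrpCat.{w})
  [∀ I : Type w, PreservesLimitsOfShape (Discrete I) G]

lemma additive_of_preservesProducts [Preadditive C] : G.Additive := by
  have : PreservesLimitsOfShape (Discrete WalkingPair) G :=
    preservesLimitsOfShape_of_equiv (Discrete.equivalence (Equiv.ulift.{w})) G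
  have : PreservesLimitsOfShape (Discrete PEmpty.{1}) G :=
    preservesLimitsOfShape_of_equiv (Discrete.equivalence (Equiv.ulift.{w})) G
  have : HasFiniteProducts C := hasFiniteProducts_of_hasProducts C
  have : HasZeroObject C := hasZeroObject_of_hasTerminal_object
  have : G.PreservesZeroMorphisms := Functor.preservesZeroMorphisms_of_preserves_terminal_object
  exact Functor.additive_of_preserves_binary_products G

lemma exists_isPresentation {J : Type w} [SmallCategory J] (F : J ⥤ C) [F.IsDense]
    (κ : Cardinal.{w}) [Fact κ.IsRegular] [G.IsCardinalAccessible κ]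
    [∀ X, IsCardinalFiltered (CostructuredArrow F X) κ] :
    ∃ (j k : J) (g : F.obj j ⟶ F.obj k) (y : G.obj (F.obj j)), IsPresentation G g y := by
  have (X : C) := isFiltered_of_isCardinalFiltered (CostructuredArrow F X) κ
  have (X : C) := G.preservesColimitsOfShape_of_isCardinalAccessible κ (CostructuredArrow F X)
  obtain ⟨j, y, hy⟩ := exists_generator F.obj (G ⋙ forget AddCommGrpCat.{w})
    (fun ι X x => by
      obtain ⟨z, hz⟩ := exists_forall_map_π_eq G X x
      exact ⟨_, z, Pi.π X, hz⟩)
    (fun X => exists_map_eq_of_isDense F G)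
  obtain ⟨k, ⟨g, hg⟩, hk⟩ := exists_generator F.obj (annihilator G y).toFunctor
    (fun ι X f => by
      refine ⟨_, ⟨Pi.lift fun i => (f i).1, eq_zero_of_forall_map_π_eq_zero G fun i => ?_⟩, Pi.π X,
        fun i => Subtype.ext (Pi.lift_π _ i)⟩
      rw [← Functor.map_comp_apply, Pi.lift_π]
      exact (f i).2)
    (fun X f => by
      obtain ⟨k, g, h, hgh, hg⟩ := exists_fac_map_eq_zero_of_isDense F G y f.1 f.2
      exact ⟨k, h, ⟨F.map g, hg⟩, Subtype.ext hgh⟩)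
  refine ⟨j, k, g, y, ⟨hy _, fun {X} f => ⟨fun hf => ?_, ?_⟩⟩⟩
  · obtain ⟨h, hh⟩ := hk X ⟨f, hf⟩
    exact ⟨h, congrArg Subtype.val hh⟩
  · rintro ⟨h, rfl⟩
    rw [Functor.map_comp_apply, hg, map_zero]

end Products

end

variable {R : Type u} [SmallCategory R] [Preadditive R]

section Closure
instance (J : Type u) [SmallCategory J] :
    (additiveFunctor R AddCommGrpCat.{u}).IsClosedUnderLimitsOfShape J where
  limitsOfShape_le := by
    rintro G ⟨h⟩
    refine ⟨fun {X Y f g} => (isLimitOfPreserves ((evaluation _ _).obj Y) h.isLimit).hom_ext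
      fun j => ?_⟩
    have : (h.diag.obj j).Additive := h.prop_diag_obj j
    simp [Preadditive.add_comp]

instance (J : Type u) [SmallCategory J] :
    (additiveFunctor R AddCommGrpCat.{u}).IsClosedUnderColimitsOfShape J where
  colimitsOfShape_le := by
    rintro G ⟨h⟩
    refine ⟨fun {X Y f g} => (isColimitOfPreserves ((evaluation _ _).obj X) h.isColimit).hom_ext
      fun j => ?_⟩
    have : (h.diag.obj j).Additive := h.prop_diag_obj j
    simp [Preadditive.comp_add, ← NatTrans.naturality]

instance (κ : Cardinal.{u}) (J : Type u) [SmallCategory J] :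
    (preservesSmallProducts κ R).IsClosedUnderLimitsOfShape J where
  limitsOfShape_le := by
    rintro M ⟨h⟩ I hI
    have := isClosedUnderLimitsOfShape_preservesLimitsOfShape (Discrete I) J R AddCommGrpCat.{u}
    exact ObjectProperty.prop_of_isLimit (ObjectProperty.preservesLimitsOfShape (Discrete I))
      (isLimitOfPreserves (additiveFunctor R AddCommGrpCat.{u}).ι h.isLimit)
      fun j => h.prop_diag_obj j I hI

lemma isClosedUnderColimitsOfShape_preservesSmallProducts (κ : Cardinal.{u}) [Fact κ.IsRegular]
    (J : Type u) [SmallCategory J] [IsCardinalFiltered J κ] :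
    (preservesSmallProducts κ R).IsClosedUnderColimitsOfShape J where
  colimitsOfShape_le := by
    rintro M ⟨h⟩ I hI
    have := preservesLimitsOfShape_colim κ J ((hasCardinalLT_iff_cardinal_mk_lt I κ).2 hI)
    exact ObjectProperty.prop_of_isColimit (ObjectProperty.preservesLimitsOfShape (Discrete I))
      (isColimitOfPreserves (additiveFunctor R AddCommGrpCat.{u}).ι h.isColimit)
      fun j => h.prop_diag_obj j I hI

instance (κ : Cardinal.{u}) [Fact κ.IsRegular] :
    (preservesSmallProducts κ R).ι.IsCardinalAccessible κ where
  preservesColimitOfShape J _ _ := by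
    have := isClosedUnderColimitsOfShape_preservesSmallProducts (R := R) κ J
    infer_instance

lemma funCard_restrict (κ : Cardinal.{u}) [Fact κ.IsRegular]
    {F : LeftMod R ⥤ AddCommGrpCat.{u}} (hF : funFin (LeftMod R) F) :
    funCard κ (ProdMod κ R) (restrict κ F) := by
  obtain ⟨haccessible, hproducts⟩ := hF
  have : Fact (Cardinal.aleph0.{u}).IsRegular := Cardinal.fact_isRegular_aleph0
  have := F.isCardinalAccessible_of_le (Cardinal.IsRegular.aleph0_le (Fact.out : κ.IsRegular))
  exact ⟨inferInstance, fun J => have := hproducts J; inferInstance⟩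

end Closure

lemma funCard_of_iso {κ : Cardinal.{u}} [Fact κ.IsRegular] {C : Type (u + 1)} [Category.{u} C]
    {F G : C ⥤ AddCommGrpCat.{u}} (e : F ≅ G) (hF : funCard κ C F) : funCard κ C G := by
  obtain ⟨haccessible, hproducts⟩ := hF
  exact ⟨Functor.isCardinalAccessible_of_natIso e κ,
    fun J => have := hproducts J; preservesLimitsOfShape_of_natIso e⟩

/-- Evaluation of left modules at an object. -/
abbrev evalMod (n : R) : LeftMod R ⥤ AddCommGrpCat.{u} :=
  (additiveFunctor R AddCommGrpCat.{u}).ι ⋙ (evaluation _ _).obj n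

namespace PPFormula

variable {n : R} (φ : PPFormula R n)

lemma exists_sol_of_isColimit {J : Type u} [SmallCategory J] [IsFiltered J] {K : J ⥤ LeftMod R}
    {c : Cocone K} (hc : IsColimit c) {j : J} (x : (K.obj j).obj.obj n)
    (hx : (c.ι.app j).hom.app n x ∈ φ.sol c.pt) :
    ∃ (k : J) (f : j ⟶ k), (K.map f).hom.app n x ∈ φ.sol (K.obj k) := by
  obtain ⟨y, hy⟩ := hx
  obtain ⟨i, y, rfl⟩ := Concrete.isColimit_exists_rep _ (isColimitOfPreserves (evalMod φ.l) hc) y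
  have heq : (c.ι.app j).hom.app φ.m ((K.obj j).obj.map φ.A x) =
      (c.ι.app i).hom.app φ.m ((K.obj i).obj.map φ.B y) := by
    rw [NatTrans.naturality_apply, NatTrans.naturality_apply]
    exact hy
  obtain ⟨k, f, g, h⟩ := Concrete.isColimit_exists_of_rep_eq _
    (isColimitOfPreserves (evalMod φ.m) hc) _ _ heq
  refine ⟨k, f, (K.map g).hom.app φ.l y, ?_⟩
  rw [← NatTrans.naturality_apply, ← NatTrans.naturality_apply]
  exact h

lemma mem_sol_of_isLimit {J : Type u} {K : Discrete J ⥤ LeftMod R} {c : Cone K}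
    (hc : IsLimit c) (x : c.pt.obj.obj n)
    (hx : ∀ j, (c.π.app j).hom.app n x ∈ φ.sol (K.obj j)) : x ∈ φ.sol c.pt := by
  choose y hy using hx
  obtain ⟨z, hz⟩ := exists_forall_π_eq_of_isLimit (isLimitOfPreserves (evalMod φ.l) hc)
    fun j => y ⟨j⟩
  refine ⟨z, Concrete.isLimit_ext _ (isLimitOfPreserves (evalMod φ.m) hc) _ _ fun j => ?_⟩
  have hz : (c.π.app j).hom.app φ.l z = y j := hz j.as
  refine (NatTrans.naturality_apply (c.π.app j).hom φ.A x).trans ((hy j).trans ?_)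
  rw [← hz]
  exact (NatTrans.naturality_apply (c.π.app j).hom φ.B z).symm

end PPFormula

namespace PPPair

variable {n : R} (p : PPPair R n)

/-- The class in `F_{φ/ψ} M` of a solution of `φ` in `M`. -/
def cls {M : LeftMod R} (x : M.obj.obj n) (hx : x ∈ p.φ.sol M) : p.functor.obj M :=
  QuotientAddGroup.mk (⟨x, hx⟩ : p.φ.sol M)

lemma cls_surjective {M : LeftMod R} (y : p.functor.obj M) :
    ∃ (x : M.obj.obj n) (hx : x ∈ p.φ.sol M), p.cls x hx = y := by
  obtain ⟨⟨x, hx⟩, rfl⟩ := QuotientAddGroup.mk_surjective y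
  exact ⟨x, hx, rfl⟩

lemma cls_eq_zero_iff {M : LeftMod R} {x : M.obj.obj n} (hx : x ∈ p.φ.sol M) :
    p.cls x hx = 0 ↔ x ∈ p.ψ.sol M :=
  (QuotientAddGroup.eq_zero_iff _).trans AddSubgroup.mem_addSubgroupOf

lemma map_cls_eq {M N : LeftMod R} {f : M ⟶ N} {x : M.obj.obj n} {y : N.obj.obj n}
    (hx : x ∈ p.φ.sol M) (hxy : f.hom.app n x = y) :
    p.functor.map f (p.cls x hx) = p.cls y (hxy ▸ p.φ.sol_map f hx) := by
  subst hxy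
  rfl

lemma preservesColimitsOfShape_functor (J : Type u) [SmallCategory J] [IsFiltered J] :
    PreservesColimitsOfShape J p.functor := by
  refine ⟨⟨fun {c} hc => nonempty_isColimit_of_isFiltered (fun y => ?_) (fun j y hy => ?_)⟩⟩
  · obtain ⟨x, hx, rfl⟩ := p.cls_surjective y
    obtain ⟨j, x, rfl⟩ := Concrete.isColimit_exists_rep _ (isColimitOfPreserves (evalMod n) hc) x
    obtain ⟨k, f, hf⟩ := p.φ.exists_sol_of_isColimit hc x hx
    exact ⟨k, p.cls _ hf, p.map_cls_eq hf (((evalMod n).mapCocone c).w_apply f x)⟩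
  · obtain ⟨x, hx, rfl⟩ := p.cls_surjective y
    obtain ⟨k, f, hf⟩ := p.ψ.exists_sol_of_isColimit hc x ((p.cls_eq_zero_iff _).1 hy)
    exact ⟨k, f, (p.cls_eq_zero_iff (p.φ.sol_map _ hx)).2 hf⟩

lemma preservesProducts_functor (J : Type u) :
    PreservesLimitsOfShape (Discrete J) p.functor := by
  refine ⟨⟨fun {c} hc => nonempty_isLimit_of_discrete (fun y hy => ?_) (fun y => ?_)⟩⟩
  · obtain ⟨x, hx, rfl⟩ := p.cls_surjective y
    exact (p.cls_eq_zero_iff hx).2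
      (p.ψ.mem_sol_of_isLimit hc x fun j => (p.cls_eq_zero_iff _).1 (hy j.as))
  · choose x hx hxy using fun j => p.cls_surjective (y j)
    obtain ⟨z, hz⟩ := exists_forall_π_eq_of_isLimit (isLimitOfPreserves (evalMod n) hc) x
    have hz (j : J) : (c.π.app ⟨j⟩).hom.app n z = x j := hz j
    have hzφ : z ∈ p.φ.sol c.pt := p.φ.mem_sol_of_isLimit hc z fun j => by
      rw [hz j.as]
      exact hx j.as
    exact ⟨p.cls z hzφ, fun j => (p.map_cls_eq hzφ (hz j)).trans (hxy j)⟩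

lemma funFin_functor : funFin (LeftMod R) p.functor := by
  have : Fact (Cardinal.aleph0.{u}).IsRegular := Cardinal.fact_isRegular_aleph0
  refine ⟨⟨fun J _ _ => ?_⟩, p.preservesProducts_functor⟩
  have := isFiltered_of_isCardinalFiltered J Cardinal.aleph0.{u}
  exact p.preservesColimitsOfShape_functor J

end PPPair

section

variable {C : Type*} [Category* C] {D : Type*} [Category* D]

/-- The functor `F'` differs from `F` only on the objects satisfying `P`, where its values are those
of `G`, and morphisms are transported along the components of `e`. -/
lemma exists_iso_comp_eq {P : ObjectProperty C} {G : P.FullSubcategory ⥤ D} {F : C ⥤ D}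
    (e : P.ι ⋙ F ≅ G) : ∃ F' : C ⥤ D, Nonempty (F ≅ F') ∧ G = P.ι ⋙ F' := by
  classical
  let obj (X : C) : Σ Y : D, (F.obj X ≅ Y) :=
    if h : P X then ⟨G.obj ⟨X, h⟩, e.app ⟨X, h⟩⟩ else ⟨_, Iso.refl _⟩
  have hobj (X : P.FullSubcategory) : obj X.obj = ⟨G.obj X, e.app X⟩ := dif_pos X.property
  refine ⟨F.copyObj (fun X => (obj X).1) (fun X => (obj X).2), ⟨F.isoCopyObj _ _⟩, ?_⟩
  have key (X Y : P.FullSubcategory) (f : X ⟶ Y) (a : Σ A : D, (F.obj X.obj ≅ A))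
      (b : Σ A : D, (F.obj Y.obj ≅ A)) (ha : a = ⟨G.obj X, e.app X⟩)
      (hb : b = ⟨G.obj Y, e.app Y⟩) :
      HEq (G.map f) (a.2.inv ≫ F.map f.hom ≫ b.2.hom) := by
    subst ha hb
    exact heq_of_eq (NatIso.naturality_1 e f).symm
  exact Functor.hext (fun X => (congrArg Sigma.fst (hobj X)).symm)
    (fun X Y f => key X Y f _ _ (hobj X) (hobj Y))

end

section PresentedModules

variable {n m : R} (A : n ⟶ m)

/-- The cokernel of the map `R(m, -) ⟶ R(n, -)` given by precomposition with `A`, that is, the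
module generated by an element of degree `n` with the relation `A`. -/
def presentedFunctor : R ⥤ AddCommGrpCat.{u} where
  obj t := AddCommGrpCat.of ((n ⟶ t) ⧸ (Preadditive.leftComp t A).range)
  map {s t} f := AddCommGrpCat.ofHom
    (QuotientAddGroup.map _ _ (Preadditive.rightComp n f) (by
      rintro _ ⟨g, rfl⟩
      exact ⟨g ≫ f, (Category.assoc _ _ _).symm⟩))
  map_id t := by
    ext x
    exact congrArg QuotientAddGroup.mk (Category.comp_id x)
  map_comp f g := by
    ext x
    exact congrArg QuotientAddGroup.mk (Category.assoc x f g).symm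

/-- The generator of the presented module: the class of the identity. -/
def generator : (presentedFunctor A).obj n :=
  QuotientAddGroup.mk (𝟙 n)

lemma map_generator {t : R} (f : n ⟶ t) :
    (presentedFunctor A).map f (generator A) = QuotientAddGroup.mk f :=
  congrArg QuotientAddGroup.mk (Category.id_comp f)

lemma isPresentation_presentedFunctor : IsPresentation (presentedFunctor A) A (generator A) where
  exists_map_eq x := by
    obtain ⟨f, rfl⟩ := QuotientAddGroup.mk_surjective x
    exact ⟨f, map_generator A f⟩
  map_eq_zero_iff f := by
    rw [map_generator]
    exact QuotientAddGroup.eq_zero_iff f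

instance : (presentedFunctor A).Additive where
  map_add {s t f g} := by
    ext x
    obtain ⟨x, rfl⟩ := QuotientAddGroup.mk_surjective x
    exact congrArg QuotientAddGroup.mk (Preadditive.comp_add _ _ _ x f g)

/-- The presented module as an object of `ProdMod κ R`. -/
abbrev presentedMod (κ : Cardinal.{u}) : ProdMod κ R :=
  ⟨⟨presentedFunctor A, inferInstanceAs (presentedFunctor A).Additive⟩,
    fun J _ => (isPresentation_presentedFunctor A).preservesProducts J⟩

variable {A} {κ : Cardinal.{u}} {X : ProdMod κ R}

lemma presentedMod_hom_ext {f g : presentedMod A κ ⟶ X}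
    (h : f.hom.hom.app n (generator A) = g.hom.hom.app n (generator A)) : f = g := by
  ext : 2
  exact (isPresentation_presentedFunctor A).natTrans_ext h

lemma exists_presentedMod_hom (x : X.obj.obj.obj n) (hx : X.obj.obj.map A x = 0) :
    ∃ f : presentedMod A κ ⟶ X, f.hom.hom.app n (generator A) = x := by
  have : X.obj.obj.Additive := X.obj.property
  obtain ⟨α, hα⟩ := (isPresentation_presentedFunctor A).exists_natTrans x hx
  exact ⟨ObjectProperty.homMk (ObjectProperty.homMk α), hα⟩

lemma map_app_generator (f : presentedMod A κ ⟶ X) :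
    X.obj.obj.map A (f.hom.hom.app n (generator A)) = 0 := by
  rw [← NatTrans.naturality_apply, (isPresentation_presentedFunctor A).map_self_eq_zero, map_zero]

end PresentedModules

section Density

/-- A morphism of `R`, regarded as the presentation of a module by one generator of degree `n` and
one relation. -/
structure Presentation (R : Type u) [SmallCategory R] where
  {n m : R}
  A : n ⟶ m

variable (κ : Cardinal.{u})

variable (R) in
/-- The full subcategory of `ProdMod κ R` on the presented modules, with objects indexed by their
presentations so that it is small. -/
abbrev Presented : Type u :=
  InducedCategory (ProdMod κ R) fun P : Presentation R => presentedMod P.A κ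

variable (R) in
/-- The inclusion of the presented modules into `ProdMod κ R`. -/
abbrev presentedInclusion : Presented R κ ⥤ ProdMod κ R :=
  inducedFunctor _

variable {κ} {X : ProdMod κ R}

/-- The object over `X` given by a morphism from a presented module. -/
abbrev overMk {n m : R} {A : n ⟶ m} (f : presentedMod A κ ⟶ X) :
    CostructuredArrow (presentedInclusion R κ) X :=
  CostructuredArrow.mk (C := Presented R κ) (S := presentedInclusion R κ) (Y := .mk A) f

/-- The image in `X` of the generator of a presented module over `X`. -/
abbrev overElt (j : CostructuredArrow (presentedInclusion R κ) X) : X.obj.obj.obj j.left.n :=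
  j.hom.hom.hom.app _ (generator j.left.A)

lemma exists_over_hom {j k : CostructuredArrow (presentedInclusion R κ) X}
    (e : k.left.n ⟶ j.left.n)
    (he : ∃ h, k.left.A ≫ h = e ≫ j.left.A) (hX : X.obj.obj.map e (overElt k) = overElt j) :
    ∃ f : j ⟶ k, f.left.hom.hom.hom.app _ (generator j.left.A) =
      (presentedFunctor k.left.A).map e (generator k.left.A) := by
  obtain ⟨f, hf⟩ := exists_presentedMod_hom (X := presentedMod k.left.A κ) (A := j.left.A)
    ((presentedFunctor k.left.A).map e (generator k.left.A)) (by
      rw [← Functor.map_comp_apply]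
      exact ((isPresentation_presentedFunctor _).map_eq_zero_iff _).2 he)
  refine ⟨CostructuredArrow.homMk (InducedCategory.homMk f) (presentedMod_hom_ext ?_), hf⟩
  refine Eq.trans ?_ hX
  exact (congrArg (k.hom.hom.hom.app _) hf).trans (NatTrans.naturality_apply _ _ _)

lemma over_w_app {j k : CostructuredArrow (presentedInclusion R κ) X} (f : j ⟶ k) {t : R}
    (x : (presentedFunctor j.left.A).obj t) :
    k.hom.hom.hom.app t (f.left.hom.hom.hom.app t x) = j.hom.hom.hom.app t x :=
  congrArg (fun g => g.hom.hom.app t x) (CostructuredArrow.w f)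

lemma exists_over_forall_nonempty_hom (hR : HasSmallProducts κ R) {ι : Type u}
    (hι : Cardinal.mk ι < κ) (j : ι → CostructuredArrow (presentedInclusion R κ) X) :
    ∃ k, ∀ i, Nonempty (j i ⟶ k) := by
  have := hR ι hι
  have := X.property ι hι
  let A := Limits.Pi.map fun i => (j i).left.A
  have hA (i : ι) : A ≫ Pi.π _ i = Pi.π _ i ≫ (j i).left.A := Limits.Pi.map_π _ i
  obtain ⟨x, hx⟩ := exists_forall_map_π_eq X.obj.obj _ fun i => overElt (j i)
  obtain ⟨f, hf⟩ := exists_presentedMod_hom (κ := κ) (A := A) x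
    (eq_zero_of_forall_map_π_eq_zero _ fun i => by
      rw [← Functor.map_comp_apply, hA, Functor.map_comp_apply, hx]
      exact map_app_generator (j i).hom)
  exact ⟨overMk f, fun i => (exists_over_hom (j := j i) (k := overMk f) (Pi.π _ i) ⟨_, hA i⟩
    ((congrArg _ hf).trans (hx i))).nonempty⟩

lemma exists_over_hom_forall_eq_zero [HasBinaryBiproducts R] (hR : HasSmallProducts κ R)
    {ι : Type u} (hι : Cardinal.mk ι < κ) (j : CostructuredArrow (presentedInclusion R κ) X)
    (t : ι → R) (y : ∀ i, (presentedFunctor j.left.A).obj (t i))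
    (hy : ∀ i, j.hom.hom.hom.app _ (y i) = 0) :
    ∃ (k : _) (f : j ⟶ k), ∀ i, f.left.hom.hom.hom.app _ (y i) = 0 := by
  have := hR ι hι
  have := X.property ι hι
  have : X.obj.obj.Additive := X.obj.property
  choose e he using fun i => (isPresentation_presentedFunctor j.left.A).exists_map_eq (y i)
  obtain rfl : (fun i => (presentedFunctor _).map (e i) (generator _)) = y := funext he
  let A := biprod.lift j.left.A (Pi.lift e)
  have hlift : X.obj.obj.map (Pi.lift e) (overElt j) = 0 :=
    eq_zero_of_forall_map_π_eq_zero _ fun i => by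
      rw [← Functor.map_comp_apply, Pi.lift_π, ← hy i]
      exact (NatTrans.naturality_apply j.hom.hom.hom _ _).symm
  have hA : X.obj.obj.map A (overElt j) = 0 := by
    rw [show A = _ from biprod.lift_eq, Functor.map_add, AddCommGrpCat.hom_add_apply,
      Functor.map_comp_apply, Functor.map_comp_apply, hlift, map_app_generator, map_zero,
      map_zero, add_zero]
  obtain ⟨g, hg⟩ := exists_presentedMod_hom (overElt j) hA
  obtain ⟨f, hf⟩ := exists_over_hom (j := j) (k := overMk g) (𝟙 _)
    ⟨biprod.fst, (biprod.lift_fst _ _).trans (Category.id_comp _).symm⟩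
    ((Functor.map_id_apply _ _ _).trans hg)
  refine ⟨overMk g, f, fun i => ?_⟩
  rw [NatTrans.naturality_apply, hf, ← Functor.map_comp_apply]
  exact ((isPresentation_presentedFunctor A).map_eq_zero_iff _).2 ⟨biprod.snd ≫ Pi.π _ i, by
    rw [biprod.lift_snd_assoc, Pi.lift_π, Category.id_comp]⟩

variable [HasBinaryBiproducts R] [Fact κ.IsRegular]

lemma isCardinalFiltered_over (hR : HasSmallProducts κ R) (X : ProdMod κ R) :
    IsCardinalFiltered (CostructuredArrow (presentedInclusion R κ) X) κ := by
  have hκ : Cardinal.aleph0 ≤ κ := Cardinal.IsRegular.aleph0_le Fact.out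
  simp only [isCardinalFiltered_iff, hasCardinalLT_iff_cardinal_mk_lt]
  refine ⟨fun ι j hι => exists_over_forall_nonempty_hom hR hι j, fun ι j k f hι => ?_⟩
  obtain ⟨l, hl⟩ := exists_over_forall_nonempty_hom hR (Cardinal.mk_lt_aleph0.trans_le hκ)
    (fun b : ULift.{u} Bool => if b.down then j else k)
  obtain ⟨p⟩ : Nonempty (j ⟶ l) := hl ⟨true⟩
  obtain ⟨q⟩ : Nonempty (k ⟶ l) := hl ⟨false⟩
  obtain ⟨m, r, hr⟩ := exists_over_hom_forall_eq_zero hR hι l (fun _ => j.left.n)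
    (fun i => (f i ≫ q).left.hom.hom.hom.app _ (generator j.left.A) -
      p.left.hom.hom.hom.app _ (generator j.left.A))
    (fun i => by rw [map_sub, over_w_app, over_w_app, sub_self])
  refine ⟨m, q ≫ r, p ≫ r, fun i => ?_⟩
  ext : 2
  refine presentedMod_hom_ext (sub_eq_zero.1 ?_)
  exact (map_sub (r.left.hom.hom.hom.app _).hom _ _).symm.trans (hr i)

lemma isDense_presentedInclusion (hR : HasSmallProducts κ R) :
    (presentedInclusion R κ).IsDense where
  isDenseAt X := by
    have := isCardinalFiltered_over hR X
    have := isFiltered_of_isCardinalFiltered (CostructuredArrow (presentedInclusion R κ) X) κ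
    let Φ := (preservesSmallProducts κ R).ι ⋙ (additiveFunctor R AddCommGrpCat.{u}).ι
    refine nonempty_isColimit_canonicalCocone_iff.1 ⟨isColimitOfReflects Φ
      (evaluationJointlyReflectsColimits _ fun t => Nonempty.some ?_)⟩
    refine nonempty_isColimit_of_isFiltered (fun (x : X.obj.obj.obj t) => ?_)
      (fun (j : CostructuredArrow _ _) (y : (presentedFunctor j.left.A).obj t) hy => ?_)
    · obtain ⟨f, hf⟩ := exists_presentedMod_hom (κ := κ) (A := (0 : t ⟶ t)) x (by simp)
      exact ⟨overMk f, generator _, hf⟩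
    · obtain ⟨k, f, hf⟩ := exists_over_hom_forall_eq_zero hR (ι := PUnit.{u + 1})
        (Cardinal.mk_lt_aleph0.trans_le (Cardinal.IsRegular.aleph0_le Fact.out)) j (fun _ => t)
        (fun _ => y) (fun _ => hy)
      exact ⟨k, f, hf ⟨⟩⟩

end Density

section Formulas

variable {n m l k : R} (A : n ⟶ m) (B : l ⟶ k) (e : l ⟶ n)

/-- The pp-formula `A x = 0`. -/
def kerFormula : PPFormula R n := ⟨m, m, A, 0⟩

lemma mem_sol_kerFormula {M : LeftMod R} {x : M.obj.obj n} :
    x ∈ (kerFormula A).sol M ↔ M.obj.map A x = 0 := by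
  have hzero (y : M.obj.obj m) : M.obj.map (0 : m ⟶ m) y = 0 := by
    rw [Functor.map_zero, AddCommGrpCat.zero_apply]
  exact ⟨fun ⟨y, hy⟩ => hy.trans (hzero y), fun h => ⟨0, h.trans (hzero 0).symm⟩⟩

variable [HasBinaryBiproducts R]

/-- The pp-formula expressing that `x = e y` for some `y` with `B y = 0`. -/
def imageFormula : PPFormula R n := ⟨n ⊞ k, l, biprod.inl, biprod.lift e B⟩

lemma mem_sol_imageFormula {M : LeftMod R} {x : M.obj.obj n} :
    x ∈ (imageFormula B e).sol M ↔
      ∃ y : M.obj.obj l, M.obj.map e y = x ∧ M.obj.map B y = 0 := by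
  have hlift (y : M.obj.obj l) : M.obj.map (biprod.lift e B) y =
      M.obj.map biprod.inl (M.obj.map e y) + M.obj.map biprod.inr (M.obj.map B y) := by
    rw [biprod.lift_eq, Functor.map_add, AddCommGrpCat.hom_add_apply, Functor.map_comp_apply,
      Functor.map_comp_apply]
  constructor
  · rintro ⟨(y : M.obj.obj l), (hy : M.obj.map biprod.inl x = M.obj.map (biprod.lift e B) y)⟩
    refine ⟨y, ?_, ?_⟩
    · have := congrArg (M.obj.map biprod.fst) hy
      rw [← Functor.map_comp_apply, ← Functor.map_comp_apply, biprod.lift_fst, biprod.inl_fst,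
        Functor.map_id_apply] at this
      exact this.symm
    · have := congrArg (M.obj.map biprod.snd) hy
      rw [← Functor.map_comp_apply, ← Functor.map_comp_apply, biprod.lift_snd, biprod.inl_snd,
        Functor.map_zero, AddCommGrpCat.zero_apply] at this
      exact this.symm
  · rintro ⟨y, rfl, hy⟩
    refine ⟨y, Eq.trans ?_ (hlift y).symm⟩
    rw [hy, map_zero, add_zero]
    rfl

/-- The pp-pair of the formulas `A x = 0` and `x = e y` with `B y = 0`, where `A e` factors
through `B`. -/
def cokerPair (h : k ⟶ m) (w : B ≫ h = e ≫ A) : PPPair R n where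
  φ := kerFormula A
  ψ := imageFormula B e
  le M x hx := by
    obtain ⟨y, rfl, hy⟩ := (mem_sol_imageFormula B e).1 hx
    rw [mem_sol_kerFormula, ← Functor.map_comp_apply, ← w, Functor.map_comp_apply, hy, map_zero]

end Formulas

variable [HasBinaryBiproducts R] {κ : Cardinal.{u}}

lemma exists_ppPair_isPresentation {n m l k : R} {A : n ⟶ m} {B : l ⟶ k}
    (g : presentedMod A κ ⟶ presentedMod B κ) :
    ∃ (p : PPPair R n) (y : p.functor.obj (presentedMod A κ).obj),
      IsPresentation (restrict κ p.functor) g y := by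
  obtain ⟨e, he⟩ := (isPresentation_presentedFunctor B).exists_map_eq
    (g.hom.hom.app n (generator A))
  obtain ⟨h, w⟩ := ((isPresentation_presentedFunctor B).map_eq_zero_iff (e ≫ A)).1 (by
    rw [Functor.map_comp_apply, he]
    exact map_app_generator g)
  have hg {X : ProdMod κ R} (f : presentedMod B κ ⟶ X) :
      (g ≫ f).hom.hom.app n (generator A) = X.obj.obj.map e (f.hom.hom.app l (generator B)) :=
    (congrArg (f.hom.hom.app n) he.symm).trans (NatTrans.naturality_apply _ _ _)
  have hgen : generator A ∈ (kerFormula A).sol (presentedMod A κ).obj :=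
    (mem_sol_kerFormula A).2 (isPresentation_presentedFunctor A).map_self_eq_zero
  let p := cokerPair A B e h w
  refine ⟨p, p.cls (generator A) hgen, fun {X} x => ?_, fun {X} f => ?_⟩
  · obtain ⟨x, hx, rfl⟩ := p.cls_surjective x
    obtain ⟨f, hf⟩ := exists_presentedMod_hom x ((mem_sol_kerFormula A).1 hx)
    exact ⟨f, p.map_cls_eq _ hf⟩
  · refine (p.cls_eq_zero_iff ((kerFormula A).sol_map f.hom hgen)).trans
      ((mem_sol_imageFormula B e).trans ⟨?_, ?_⟩)
    · rintro ⟨y, hy, hBy⟩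
      obtain ⟨a, ha⟩ := exists_presentedMod_hom y hBy
      exact ⟨a, presentedMod_hom_ext ((hg a).trans ((congrArg _ ha).trans hy))⟩
    · rintro ⟨a, rfl⟩
      exact ⟨_, (hg a).symm, map_app_generator a⟩

lemma exists_ppPair_of_funCard [Fact κ.IsRegular] (hR : HasSmallProducts κ R)
    {G : ProdMod κ R ⥤ AddCommGrpCat.{u}} (hG : funCard κ (ProdMod κ R) G) :
    ∃ (n : R) (p : PPPair R n), Nonempty (G ≅ restrict κ p.functor) := by
  obtain ⟨_, hprod⟩ := hG
  have := isDense_presentedInclusion hR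
  have := isCardinalFiltered_over hR
  have : HasProducts.{u} (ProdMod κ R) := fun J => inferInstance
  obtain ⟨j, k, g, y, hy⟩ := exists_isPresentation G (presentedInclusion R κ) κ
  obtain ⟨p, z, hz⟩ := exists_ppPair_isPresentation g
  have := (funCard_restrict κ p.funFin_functor).2
  have := additive_of_preservesProducts G
  have := additive_of_preservesProducts (restrict κ p.functor)
  exact ⟨_, p, hy.nonempty_iso hz⟩

end LambdaModules

end

theorem mainTheorem2 (κ : Cardinal.{u}) [Fact κ.IsRegular]
    (R : Type u) [SmallCategory R] [Preadditive R] [HasFiniteBiproducts R]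
    (hR : LambdaModules.HasSmallProducts κ R) :
    (∀ G : LambdaModules.ProdMod κ R ⥤ AddCommGrpCat.{u},
      LambdaModules.funCard κ (LambdaModules.ProdMod κ R) G ↔
        ∃ F : LambdaModules.LeftMod R ⥤ AddCommGrpCat.{u},
          LambdaModules.funFin (LambdaModules.LeftMod R) F ∧ G = LambdaModules.restrict κ F) ∧
    (∀ G : LambdaModules.ProdMod κ R ⥤ AddCommGrpCat.{u},
      LambdaModules.funCard κ (LambdaModules.ProdMod κ R) G ↔
        ∃ (n : R) (p : LambdaModules.PPPair R n),
          Nonempty (G ≅ LambdaModules.restrict κ p.functor)) := by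
  have := HasBinaryBiproducts.of_hasBinaryProducts (C := R)
  refine ⟨fun G => ⟨fun hG => ?_, ?_⟩, fun G => ⟨LambdaModules.exists_ppPair_of_funCard hR, ?_⟩⟩
  · obtain ⟨n, p, ⟨i⟩⟩ := LambdaModules.exists_ppPair_of_funCard hR hG
    obtain ⟨F, ⟨j⟩, hF⟩ := LambdaModules.exists_iso_comp_eq i.symm
    have : Fact (Cardinal.aleph0.{u}).IsRegular := Cardinal.fact_isRegular_aleph0
    exact ⟨F, LambdaModules.funCard_of_iso j p.funFin_functor, hF⟩
  · rintro ⟨F, hF, rfl⟩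
    exact LambdaModules.funCard_restrict κ hF
  · rintro ⟨n, p, ⟨i⟩⟩
    exact LambdaModules.funCard_of_iso i.symm (LambdaModules.funCard_restrict κ p.funFin_functor)
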